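/- For a positive integer $m$ and bipartite graphs $H_1, H_2$, let $BR_m(H_1,H_2)$ denote the least integer $n$ (if one exists) such that for every colouring of the edges of the complete bipartite graph $K_{m,n}$ with the colours red and blue, the red graph contains a copy of $H_1$ as a (not necessarily induced) subgraph or the blue graph contains a copy of $H_2$. Then $$BR_9(K_{2,2},K_{4,4})=14.$$ That is, every red-blue colouring of $K_{9,14}$ has a red $K_{2,2}$ or a blue $K_{4,4}$, and for every $n<14$ there is a red-blue colouring of $K_{9,n}$ with neither. -/

import Mathlib

/-- The bipartite arrow relation `K_{m,n} → (H₁, H₂)`: in every colouring of the edges of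
`K_{m,n}` with the colours red and blue, the red graph `G` contains a copy of `H₁` or the blue
graph (the complement of `G` inside `K_{m,n}`) contains a copy of `H₂`. -/
def BipartiteArrows {V₁ V₂ : Type*} (m n : ℕ) (H₁ : SimpleGraph V₁) (H₂ : SimpleGraph V₂) : Prop :=
  ∀ G : SimpleGraph (Fin m ⊕ Fin n), G ≤ completeBipartiteGraph (Fin m) (Fin n) →
    H₁.IsContained G ∨ H₂.IsContained (completeBipartiteGraph (Fin m) (Fin n) \ G)

/-- `b` is the `m`-bipartite Ramsey number `BR_m(H₁, H₂)`: the least `n` such that every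
red-blue colouring of `K_{m,n}` has a red `H₁` or a blue `H₂`. (It need not exist.) -/
def IsBipartiteRamseyNumber {V₁ V₂ : Type*} (m : ℕ) (H₁ : SimpleGraph V₁) (H₂ : SimpleGraph V₂)
    (b : ℕ) : Prop :=
  IsLeast {n : ℕ | BipartiteArrows m n H₁ H₂} b

/-! Lower bound: take the incidence matrix of the affine plane of order three (9 points, 12 lines)
with an empty column added. Two points share one line, so there is no red `K_{2,2}`. Four points
miss at most two lines, hence at most three columns, so there is no blue `K_{4,4}`. Deleting columns
settles every `n < 14`.

Upper bound: suppose a 9 × 14 matrix is good. Double counting pairs of rows that meet in a column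
bounds the number of red entries in any submatrix (`IsGood.four_mul_sum_card_le`). Starting from the
fact that four rows jointly miss at most 3 columns, this shows that three, two and one rows miss at
most 5, 8 and 12. So every row has at least two red entries, and a direct argument gives at most
five. Over the whole matrix, twice the number of red entries plus the number of disjoint pairs of
rows is at most 78.

Permuting rows and columns preserves goodness, so a lexicographically maximal good matrix has its
rows ordered by weight and its columns sorted. These facts form `IsRowSystem`, and an exhaustive
search run by the kernel finds no such system (`keysThen_search`, made sound by `search_eq_false`).
-/

namespace BipartiteRamsey

/-! ### The search on 14-bit masks -/

/-- The number of ones among the binary digits of `x < 2 ^ 14`. -/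
def bitCount (x : ℕ) : ℕ :=
  -- The product places copies of `x` at shifts 0, 15, 30, 45. Since 15 ≡ -1 mod 4, each bit lands
  -- on a multiple of 4 in exactly one copy. Reduction mod 15 adds the hexadecimal digits, and the
  -- count is at most 14.
  Nat.mod (Nat.land (Nat.mul x (nat_lit 0x200040008001)) (nat_lit 0x111111111111111)) (nat_lit 15)

/-- Orders the 14-bit masks by ascending number of ones, then descendingly. -/
def rowKey (x : ℕ) : ℕ :=
  Nat.add (Nat.mul (Nat.sub (nat_lit 14) (bitCount x)) (nat_lit 16384)) x

/-! The combinators below are written with recursors and in continuation passing style, so that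
the kernel evaluates every intermediate value exactly once. -/

/-- Applies `k` to the numeral that `x` evaluates to. -/
def evalThen (x : ℕ) (k : ℕ → Bool) : Bool := Nat.rec false (fun y _ => k y) (Nat.succ x)

def choose (b t e : Bool) : Bool := Bool.rec e t b

def every (p : ℕ → Bool) (l : List ℕ) : Bool :=
  List.rec true (fun x _ ih => choose (p x) ih false) l

def everyBelow (p : ℕ → Bool) (n : ℕ) : Bool :=
  Nat.rec true (fun x ih => choose (p x) ih false) n

/-- Passes the members of `l` that satisfy `p`, on top of `acc`, to `k`. -/
def filterThen (p : ℕ → Bool) (l : List ℕ) : List ℕ → (List ℕ → Bool) → Bool :=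
  List.rec (fun acc k => k acc) (fun x _ ih acc k => choose (p x) (ih (x :: acc) k) (ih acc k)) l

/-- Passes the numbers `x &&& c` for `x` in `l`, on top of `acc`, to `k`. -/
def landThen (c : ℕ) (l : List ℕ) : List ℕ → (List ℕ → Bool) → Bool :=
  List.rec (fun acc k => k acc)
    (fun x _ ih acc k => evalThen (Nat.land x c) fun y => ih (y :: acc) k) l

/-- The number of masks in `l` that contain `x`. -/
def countContaining (x : ℕ) (l : List ℕ) : ℕ :=
  List.rec 0 (fun c _ ih => Bool.rec ih (Nat.succ ih) (Nat.beq (Nat.land x c) x)) l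

/-- At most `b` of the members of the mask `c` are not in the mask `y`. -/
def missAtMost (b c y : ℕ) : Bool := Nat.ble (bitCount (Nat.xor c (Nat.land c y))) b

/-- The row with key `y` may occur below a last row `x` with complement `c`, where `pairs` and
`triples` are the intersections of complements of two and of three rows including the last. -/
def compatible (x c key : ℕ) (pairs triples : List ℕ) (y : ℕ) : Bool :=
  choose (Nat.ble (bitCount (Nat.land x y)) (nat_lit 1))
    (choose (Nat.ble y key)
      (choose (missAtMost (nat_lit 8) c y)
        (choose (every (fun t => missAtMost (nat_lit 5) t y) pairs)
          (every (fun t => missAtMost (nat_lit 3) t y) triples) false) false) false) false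

/-- No `n` further rows with keys in `cands` extend the present rows. Here `s` bounds the weight
of the present rows, `u` marks the adjacent columns that agree so far, `singles` and `pairs` are
the intersections of complements of one and of two present rows. -/
def search (n : ℕ) : ℕ → ℕ → List ℕ → List ℕ → List ℕ → Bool :=
  Nat.rec (fun _ _ _ _ _ => false)
    (fun n ih s u singles pairs cands =>
      every (fun key =>
        evalThen (Nat.land key (nat_lit 16383)) fun x =>
        choose (Nat.beq (Nat.land (Nat.land x u) (Nat.div x (nat_lit 2))) (Nat.land x u))
          (evalThen (Nat.mul (bitCount x) (nat_lit 2)) fun d =>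
            evalThen (Nat.add s (Nat.add d (countContaining x singles))) fun s' =>
            choose (Nat.ble (Nat.add s' (Nat.mul d n)) (nat_lit 78))
              (evalThen (Nat.xor u (Nat.land u (Nat.xor x (Nat.div x (nat_lit 2))))) fun u' =>
                evalThen (Nat.xor (nat_lit 16383) x) fun c =>
                landThen c singles [] fun newPairs =>
                landThen c pairs [] fun newTriples =>
                filterThen (compatible x c key newPairs newTriples) cands [] fun cands' =>
                ih s' u' (c :: singles) (newPairs ++ pairs) cands') true) true)
        cands) n

/-- Passes the keys of the masks below `n` with two to five ones, on top of `acc`, to `k`. -/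
def keysThen (n : ℕ) : List ℕ → (List ℕ → Bool) → Bool :=
  Nat.rec (fun acc k => k acc)
    (fun x ih acc k =>
      choose (choose (Nat.ble (nat_lit 2) (bitCount x)) (Nat.ble (bitCount x) (nat_lit 5)) false)
        (evalThen (rowKey x) fun y => ih (y :: acc) k) (ih acc k)) n

/-! ### Kernel evaluations -/

-- The whole case analysis: `true` means that no branch reaches nine rows. The mask 8191 = 2^13 - 1
-- says that all 13 adjacent column pairs agree before any row is placed.
set_option maxRecDepth 100000 in
theorem keysThen_search :
    keysThen (nat_lit 16384) [] (search (nat_lit 9) (nat_lit 0) (nat_lit 8191) [] []) = true := by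
  decide +kernel

set_option maxRecDepth 100000 in
theorem bitCount_halving_check :
    everyBelow (fun x => Nat.beq (bitCount x)
      (Nat.add (bitCount (Nat.div x (nat_lit 2))) (Nat.mod x (nat_lit 2)))) (nat_lit 16384) = true := by
  decide +kernel

/-! ### Meaning of the bit count and of the combinators -/

theorem bitCount_zero : bitCount 0 = 0 := rfl

attribute [irreducible] bitCount

theorem choose_eq (b t e : Bool) : choose b t e = bif b then t else e := by cases b <;> rfl

theorem every_cons (p : ℕ → Bool) (x : ℕ) (l : List ℕ) :
    every p (x :: l) = choose (p x) (every p l) false := rfl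

theorem everyBelow_succ (p : ℕ → Bool) (n : ℕ) :
    everyBelow p (n + 1) = choose (p n) (everyBelow p n) false := rfl

theorem of_everyBelow {p : ℕ → Bool} {n : ℕ} (h : everyBelow p n = true) :
    ∀ x < n, p x = true := by
  induction n with
  | zero => simp
  | succ n ih =>
    intro x hx
    rw [everyBelow_succ, choose_eq] at h
    cases hp : p n with
    | false => simp [hp] at h
    | true =>
      rcases Nat.lt_succ_iff_lt_or_eq.mp hx with hx | rfl
      · exact ih (by simpa [hp] using h) x hx
      · exact hp

theorem bitCount_halving {x : ℕ} (hx : x < 16384) : bitCount x = bitCount (x / 2) + x % 2 :=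
  Nat.eq_of_beq_eq_true (of_everyBelow bitCount_halving_check x hx)

theorem bitCount_eq_sum {n x : ℕ} (hn : n ≤ 14) (hx : x < 2 ^ n) :
    bitCount x = ∑ i ∈ Finset.range n, (x.testBit i).toNat := by
  induction n generalizing x with
  | zero =>
    obtain rfl : x = 0 := by simpa using hx
    exact bitCount_zero
  | succ n ih =>
    have h14 : x < 2 ^ 14 := hx.trans_le (Nat.pow_le_pow_right (by norm_num) hn)
    rw [bitCount_halving (by simpa using h14),
      ih (by omega) (by rw [pow_succ] at hx; omega), Finset.sum_range_succ']
    simp only [Nat.testBit_succ, Nat.testBit_zero]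
    rcases Nat.mod_two_eq_zero_or_one x with h | h <;> simp [h]

theorem bitCount_eq_card {x : ℕ} (hx : x < 2 ^ 14) :
    bitCount x = (Finset.univ.filter fun j : Fin 14 => x.testBit j).card := by
  rw [bitCount_eq_sum le_rfl hx, Finset.sum_range, Finset.card_filter]
  exact Finset.sum_congr rfl fun j _ => by cases x.testBit j <;> rfl

theorem bitCount_le {x : ℕ} (hx : x < 2 ^ 14) : bitCount x ≤ 14 := by
  rw [bitCount_eq_card hx]
  exact (Finset.card_le_univ _).trans (by simp)

theorem rowKey_eq (x : ℕ) : rowKey x = (14 - bitCount x) * 2 ^ 14 + x := rfl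

theorem bitCount_le_of_rowKey_le {x y : ℕ} (hx : x < 2 ^ 14) (hy : y < 2 ^ 14)
    (h : rowKey y ≤ rowKey x) : bitCount x ≤ bitCount y := by
  have h1 := bitCount_le hx
  have h2 := bitCount_le hy
  rw [rowKey_eq, rowKey_eq] at h
  omega

theorem rowKey_land {x : ℕ} (hx : x < 2 ^ 14) : Nat.land (rowKey x) 16383 = x := by
  change rowKey x &&& (2 ^ 14 - 1) = x
  rw [Nat.and_two_pow_sub_one_eq_mod, rowKey_eq]
  omega

theorem evalThen_eq (x : ℕ) (k : ℕ → Bool) : evalThen x k = k x := rfl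

theorem every_eq (p : ℕ → Bool) (l : List ℕ) : every p l = l.all p := by
  induction l with
  | nil => rfl
  | cons x l ih =>
    rw [every_cons, choose_eq, ih, List.all_cons]
    cases p x <;> rfl

theorem filterThen_cons (p : ℕ → Bool) (x : ℕ) (l acc : List ℕ) (k : List ℕ → Bool) :
    filterThen p (x :: l) acc k =
      choose (p x) (filterThen p l (x :: acc) k) (filterThen p l acc k) := rfl

theorem filterThen_eq (p : ℕ → Bool) (l acc : List ℕ) (k : List ℕ → Bool) :
    filterThen p l acc k = k ((l.filter p).reverse ++ acc) := by
  induction l generalizing acc with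
  | nil => rfl
  | cons x l ih =>
    rw [filterThen_cons, choose_eq, ih, ih]
    cases hp : p x <;> simp [hp]

theorem landThen_cons (c x : ℕ) (l acc : List ℕ) (k : List ℕ → Bool) :
    landThen c (x :: l) acc k = landThen c l ((x &&& c) :: acc) k := rfl

theorem landThen_eq (c : ℕ) (l acc : List ℕ) (k : List ℕ → Bool) :
    landThen c l acc k = k ((l.map (· &&& c)).reverse ++ acc) := by
  induction l generalizing acc with
  | nil => rfl
  | cons x l ih =>
    rw [landThen_cons, ih]
    simp

theorem ble_eq_decide (a b : ℕ) : Nat.ble a b = decide (a ≤ b) := by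
  rw [Bool.eq_iff_iff, decide_eq_true_iff, Nat.ble_eq]

theorem keysThen_succ (n : ℕ) (acc : List ℕ) (k : List ℕ → Bool) :
    keysThen (n + 1) acc k =
      choose (choose (Nat.ble 2 (bitCount n)) (Nat.ble (bitCount n) 5) false)
        (evalThen (rowKey n) fun y => keysThen n (y :: acc) k) (keysThen n acc k) := rfl

/-- Soundness only needs the list to contain every relevant key; `acc ⊆ l` carries the induction. -/
theorem keysThen_eq (n : ℕ) (acc : List ℕ) (k : List ℕ → Bool) :
    ∃ l, keysThen n acc k = k l ∧ acc ⊆ l ∧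
      ∀ x < n, 2 ≤ bitCount x → bitCount x ≤ 5 → rowKey x ∈ l := by
  induction n generalizing acc with
  | zero => exact ⟨acc, rfl, List.Subset.refl _, by simp⟩
  | succ n ih =>
    have key : keysThen (n + 1) acc k = if 2 ≤ bitCount n ∧ bitCount n ≤ 5
        then keysThen n (rowKey n :: acc) k else keysThen n acc k := by
      rw [keysThen_succ, evalThen_eq, choose_eq, choose_eq]
      generalize bitCount n = b
      by_cases h2 : 2 ≤ b <;> by_cases h5 : b ≤ 5 <;> simp [h2, h5, ble_eq_decide]
    rw [key]
    split_ifs with h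
    · obtain ⟨l, hl, hacc, hmem⟩ := ih (rowKey n :: acc)
      refine ⟨l, hl, List.Subset.trans (List.subset_cons_self _ _) hacc, fun x hx h2 h5 => ?_⟩
      rcases Nat.lt_succ_iff_lt_or_eq.mp hx with hx | rfl
      · exact hmem x hx h2 h5
      · exact hacc List.mem_cons_self
    · obtain ⟨l, hl, hacc, hmem⟩ := ih acc
      refine ⟨l, hl, hacc, fun x hx h2 h5 => ?_⟩
      rcases Nat.lt_succ_iff_lt_or_eq.mp hx with hx | rfl
      · exact hmem x hx h2 h5
      · exact absurd ⟨h2, h5⟩ h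

theorem land_eq_land_mod (c y : ℕ) (hc : c < 2 ^ 14) : c &&& y = c &&& (y &&& 16383) := by
  rw [Nat.and_comm y, ← Nat.and_assoc, show 16383 = 2 ^ 14 - 1 from rfl,
    Nat.and_two_pow_sub_one_eq_mod, Nat.mod_eq_of_lt hc]

/-- The complement of a 14-bit mask. -/
def compl (x : ℕ) : ℕ := 16383 ^^^ x

theorem testBit_compl (x i : ℕ) : (compl x).testBit i = (decide (i < 14) ^^ x.testBit i) := by
  rw [compl, Nat.testBit_xor, show 16383 = 2 ^ 14 - 1 from rfl, Nat.testBit_two_pow_sub_one]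

theorem compl_lt {x : ℕ} (hx : x < 2 ^ 14) : compl x < 2 ^ 14 :=
  Nat.xor_lt_two_pow (by norm_num) hx

/-- Candidates stay encoded as keys during the search: intersecting with a 14-bit mask discards the
weight stored in the high bits. -/
theorem xor_land_rowKey {c x : ℕ} (hc : c < 2 ^ 14) (hx : x < 2 ^ 14) :
    c ^^^ (c &&& rowKey x) = c &&& compl x := by
  have h : rowKey x &&& 16383 = x := rowKey_land hx
  rw [land_eq_land_mod c _ hc, h]
  apply Nat.eq_of_testBit_eq
  intro i
  rw [Nat.testBit_xor, Nat.testBit_and, Nat.testBit_and, testBit_compl]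
  by_cases hi : i < 14
  · cases c.testBit i <;> cases x.testBit i <;> simp [hi]
  · rw [Nat.testBit_eq_false_of_lt
      (hc.trans_le (Nat.pow_le_pow_right (by norm_num) (Nat.le_of_not_lt hi)))]
    rfl

theorem missAtMost_rowKey {b c x : ℕ} (hc : c < 2 ^ 14) (hx : x < 2 ^ 14)
    (h : bitCount (c &&& compl x) ≤ b) : missAtMost b c (rowKey x) = true := by
  rw [← xor_land_rowKey hc hx] at h
  exact Nat.ble_eq_true_of_le h

/-! ### Soundness of the search -/

/-- The complements of `r (k - 1), …, r 0`. -/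
def complements (r : ℕ → ℕ) : ℕ → List ℕ
  | 0 => []
  | k + 1 => compl (r k) :: complements r k

/-- Twice the degree of row `k`, plus the number of earlier rows disjoint from it. -/
def weight (r : ℕ → ℕ) (k : ℕ) : ℕ := bitCount (r k) * 2 + countContaining (r k) (complements r k)

/-- The properties that the search uses of nine rows of fourteen bits. -/
structure IsRowSystem (r : ℕ → ℕ) : Prop where
  lt : ∀ i < 9, r i < 2 ^ 14
  two_le : ∀ i < 9, 2 ≤ bitCount (r i)
  le_five : ∀ i < 9, bitCount (r i) ≤ 5
  anti : ∀ i j, i < j → j < 9 → rowKey (r j) ≤ rowKey (r i)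
  meet : ∀ i j, i < j → j < 9 → bitCount (r i &&& r j) ≤ 1
  miss_two : ∀ i j, i < j → j < 9 → bitCount (compl (r i) &&& compl (r j)) ≤ 8
  miss_three : ∀ i j k, i < j → j < k → k < 9 →
    bitCount (compl (r i) &&& compl (r j) &&& compl (r k)) ≤ 5
  miss_four : ∀ i j k l, i < j → j < k → k < l → l < 9 →
    bitCount (compl (r i) &&& compl (r j) &&& compl (r k) &&& compl (r l)) ≤ 3
  sorted : ∀ k < 9, ∀ j < 13, (∀ i < k, (r i).testBit j = (r i).testBit (j + 1)) →
    (r k).testBit j = true → (r k).testBit (j + 1) = true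
  weight_le : ∑ k ∈ Finset.range 9, weight r k ≤ 78

theorem mem_complements {r : ℕ → ℕ} {k x : ℕ} (h : x ∈ complements r k) :
    ∃ i < k, x = compl (r i) := by
  induction k with
  | zero => simp [complements] at h
  | succ k ih =>
    rcases List.mem_cons.mp h with rfl | h
    · exact ⟨k, k.lt_succ_self, rfl⟩
    · obtain ⟨i, hi, rfl⟩ := ih h
      exact ⟨i, hi.trans k.lt_succ_self, rfl⟩

theorem search_succ (n s u : ℕ) (singles pairs cands : List ℕ) :
    search (n + 1) s u singles pairs cands = every (fun key =>
        evalThen (Nat.land key 16383) fun x =>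
        choose (Nat.beq (Nat.land (Nat.land x u) (Nat.div x 2)) (Nat.land x u))
          (evalThen (Nat.mul (bitCount x) 2) fun d =>
            evalThen (Nat.add s (Nat.add d (countContaining x singles))) fun s' =>
            choose (Nat.ble (Nat.add s' (Nat.mul d n)) 78)
              (evalThen (Nat.xor u (Nat.land u (Nat.xor x (Nat.div x 2)))) fun u' =>
                evalThen (Nat.xor 16383 x) fun c =>
                landThen c singles [] fun newPairs =>
                landThen c pairs [] fun newTriples =>
                filterThen (compatible x c key newPairs newTriples) cands [] fun cands' =>
                search n s' u' (c :: singles) (newPairs ++ pairs) cands') true) true) cands := rfl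

theorem evalThen_eq_false {x y : ℕ} {k : ℕ → Bool} (hx : x = y) (h : k y = false) :
    evalThen x k = false := by
  rw [evalThen_eq, hx, h]

theorem choose_eq_false {b t : Bool} (hb : b = true) (h : t = false) :
    choose b t true = false := by
  rw [choose_eq, hb, h, cond_true]

theorem landThen_eq_false {c : ℕ} {l l' acc : List ℕ} {k : List ℕ → Bool}
    (hl : (l.map (· &&& c)).reverse ++ acc = l') (h : k l' = false) :
    landThen c l acc k = false := by
  rw [landThen_eq, hl, h]

theorem filterThen_eq_false {p : ℕ → Bool} {l l' acc : List ℕ} {k : List ℕ → Bool}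
    (hl : (l.filter p).reverse ++ acc = l') (h : k l' = false) :
    filterThen p l acc k = false := by
  rw [filterThen_eq, hl, h]

/-- One candidate that passes all tests and whose branch fails suffices. The equations name the
intermediate values in the order in which they are computed. -/
theorem search_succ_eq_false {n s u x key d s' u' c : ℕ}
    {singles pairs cands newPairs newTriples cands' : List ℕ}
    (hkey : key ∈ cands) (hx : Nat.land key 16383 = x)
    (hu : (x &&& u) &&& (x / 2) = x &&& u) (hd : bitCount x * 2 = d)
    (hs : s + (d + countContaining x singles) = s') (hle : s' + d * n ≤ 78)
    (hu' : u ^^^ (u &&& (x ^^^ (x / 2))) = u') (hc : compl x = c)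
    (hpairs : (singles.map (· &&& c)).reverse ++ [] = newPairs)
    (htriples : (pairs.map (· &&& c)).reverse ++ [] = newTriples)
    (hcands : (cands.filter (compatible x c key newPairs newTriples)).reverse ++ [] = cands')
    (h : search n s' u' (c :: singles) (newPairs ++ pairs) cands' = false) :
    search (n + 1) s u singles pairs cands = false := by
  rw [search_succ, every_eq, List.all_eq_false]
  refine ⟨key, hkey, ?_⟩
  rw [Bool.not_eq_true]
  exact evalThen_eq_false hx (choose_eq_false (Nat.beq_eq ▸ hu) (evalThen_eq_false
    (Nat.mul_eq.trans hd) (evalThen_eq_false hs (choose_eq_false (Nat.ble_eq_true_of_le hle) (evalThen_eq_false hu' (evalThen_eq_false hc (landThen_eq_false hpairs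
      (landThen_eq_false htriples (filterThen_eq_false hcands h)))))))))

theorem compatible_of {x c key y : ℕ} {pairs triples : List ℕ} (h1 : bitCount (x &&& y) ≤ 1)
    (h2 : y ≤ key) (h3 : missAtMost 8 c y = true) (h4 : ∀ t ∈ pairs, missAtMost 5 t y = true)
    (h5 : ∀ t ∈ triples, missAtMost 3 t y = true) :
    compatible x c key pairs triples y = true := by
  have e1 : Nat.ble (bitCount (Nat.land x y)) 1 = true := Nat.ble_eq_true_of_le h1
  unfold compatible
  rw [e1, Nat.ble_eq_true_of_le h2, h3, every_eq, every_eq, List.all_eq_true.mpr h4,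
    List.all_eq_true.mpr h5]
  rfl

/-- A row system traces a path that is never pruned: the next row is always among the candidates, so
the search runs into its `false` leaf. Extra candidates do no harm. -/
theorem search_eq_false {r : ℕ → ℕ} (hr : IsRowSystem r) (n : ℕ) : ∀ k s u pairs cands,
    k + n = 9 → s = ∑ i ∈ Finset.range k, weight r i →
    (∀ j, u.testBit j = true ↔ j < 13 ∧ ∀ i < k, (r i).testBit j = (r i).testBit (j + 1)) →
    (∀ x ∈ pairs, ∃ i j, i < j ∧ j < k ∧ x = compl (r i) &&& compl (r j)) →
    (∀ i, k ≤ i → i < 9 → rowKey (r i) ∈ cands) →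
    search n s u (complements r k) pairs cands = false := by
  induction n with
  | zero => intros; rfl
  | succ n ih =>
    intro k s u pairs cands hk hs hu hpairs hcands
    have hk9 : k < 9 := by omega
    have hcol : (r k &&& u) &&& (r k / 2) = r k &&& u := by
      apply Nat.eq_of_testBit_eq
      intro j
      simp only [Nat.testBit_and, Nat.testBit_div_two]
      cases hj : u.testBit j with
      | false => simp
      | true =>
        cases hj' : (r k).testBit j with
        | false => simp
        | true =>
          obtain ⟨h1, h2⟩ := (hu j).mp hj
          simpa using hr.sorted k hk9 j h1 h2 hj'
    have hs' : s + (bitCount (r k) * 2 + countContaining (r k) (complements r k)) =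
        ∑ i ∈ Finset.range (k + 1), weight r i := by
      rw [Finset.sum_range_succ, hs]; rfl
    have hsum : s + (bitCount (r k) * 2 + countContaining (r k) (complements r k)) +
        bitCount (r k) * 2 * n ≤ 78 := by
      rw [hs']
      refine le_trans ?_ hr.weight_le
      rw [← Finset.sum_range_add_sum_Ico _ (show k + 1 ≤ 9 by omega)]
      refine Nat.add_le_add_left ?_ _
      -- Rows come in ascending weight, so each later row contributes at least twice the number of
      -- ones of row `k`.
      have : (Finset.Ico (k + 1) 9).card • (bitCount (r k) * 2) ≤
          ∑ i ∈ Finset.Ico (k + 1) 9, weight r i := by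
        refine Finset.card_nsmul_le_sum _ _ _ fun i hi => ?_
        rw [Finset.mem_Ico] at hi
        have := bitCount_le_of_rowKey_le (hr.lt k hk9) (hr.lt i hi.2)
          (hr.anti k i (by omega) hi.2)
        unfold weight
        omega
      rw [Nat.card_Ico, smul_eq_mul, show 9 - (k + 1) = n by omega, mul_comm] at this
      exact this
    refine search_succ_eq_false (hcands k le_rfl hk9) (rowKey_land (hr.lt k hk9)) hcol
      rfl rfl hsum rfl rfl (List.append_nil _) (List.append_nil _) (List.append_nil _)
      (ih (k + 1) _ _ _ _ (by omega) hs' ?_ ?_ ?_)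
    · intro j
      rw [Nat.forall_lt_succ_right, ← and_assoc, ← hu j]
      simp only [Nat.testBit_xor, Nat.testBit_and, Nat.testBit_div_two]
      cases u.testBit j <;> cases (r k).testBit j <;> cases (r k).testBit (j + 1) <;> simp
    · intro x hx
      rcases List.mem_append.mp hx with hx | hx
      · simp only [List.mem_reverse, List.mem_map] at hx
        obtain ⟨y, hy, rfl⟩ := hx
        obtain ⟨i, hi, rfl⟩ := mem_complements hy
        exact ⟨i, k, hi, k.lt_succ_self, rfl⟩
      · obtain ⟨i, j, hij, hj, rfl⟩ := hpairs x hx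
        exact ⟨i, j, hij, hj.trans k.lt_succ_self, rfl⟩
    · intro m hkm hm
      have hc : ∀ i < 9, compl (r i) < 2 ^ 14 := fun i hi => compl_lt (hr.lt i hi)
      rw [List.mem_reverse, List.mem_filter]
      refine ⟨hcands m (by omega) hm, compatible_of ?_ (hr.anti k m hkm hm)
        (missAtMost_rowKey (hc k hk9) (hr.lt m hm) (hr.miss_two k m hkm hm)) ?_ ?_⟩
      · have h : rowKey (r m) &&& 16383 = r m := rowKey_land (hr.lt m hm)
        rw [land_eq_land_mod _ _ (hr.lt k hk9), h]
        exact hr.meet k m hkm hm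
      · intro t ht
        simp only [List.mem_reverse, List.mem_map] at ht
        obtain ⟨y, hy, rfl⟩ := ht
        obtain ⟨i, hi, rfl⟩ := mem_complements hy
        exact missAtMost_rowKey (Nat.and_lt_two_pow _ (hc k hk9)) (hr.lt m hm)
          (hr.miss_three i k m hi hkm hm)
      · intro t ht
        simp only [List.mem_reverse, List.mem_map] at ht
        obtain ⟨y, hy, rfl⟩ := ht
        obtain ⟨i, j, hij, hj, rfl⟩ := hpairs y hy
        exact missAtMost_rowKey (Nat.and_lt_two_pow _ (hc k hk9)) (hr.lt m hm)
          (hr.miss_four i j k m hij hj hkm hm)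

theorem not_isRowSystem (r : ℕ → ℕ) : ¬ IsRowSystem r := by
  intro hr
  obtain ⟨l, hl, -, hmem⟩ := keysThen_eq 16384 [] (search 9 0 8191 [] [])
  have h := search_eq_false hr 9 0 0 8191 [] l rfl rfl
    (fun j => by rw [show 8191 = 2 ^ 13 - 1 from rfl, Nat.testBit_two_pow_sub_one]; simp)
    (by simp) (fun i _ hi => hmem _ (hr.lt i hi) (hr.two_le i hi) (hr.le_five i hi))
  have h' : keysThen 16384 [] (search 9 0 8191 [] []) = true := keysThen_search
  rw [hl] at h'
  exact Bool.false_ne_true (h.symm.trans h')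

/-! ### Counting in good colourings -/

/-- The red-blue colouring `M` of `K_{m,n}` (red is `true`) has no red `K_{2,2}` and no blue
`K_{4,4}`. -/
structure IsGood {m n : ℕ} (M : Fin m → Fin n → Bool) : Prop where
  red : ∀ i i' j j', i ≠ i' → j ≠ j' → M i j = true → M i j' = true → M i' j = true →
    M i' j' = false
  blue : ∀ (f : Fin 4 ↪ Fin m) (g : Fin 4 ↪ Fin n), ∃ a b, M (f a) (g b) = true

variable {m n : ℕ} {M : Fin m → Fin n → Bool}

theorem IsGood.comp (hM : IsGood M) {m' n' : ℕ} (σ : Fin m' ↪ Fin m) (τ : Fin n' ↪ Fin n) :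
    IsGood fun i j => M (σ i) (τ j) where
  red _ _ _ _ hi hj := hM.red _ _ _ _ (σ.injective.ne hi) (τ.injective.ne hj)
  blue f g := hM.blue (f.trans σ) (g.trans τ)

theorem IsGood.exists_red (hM : IsGood M) {X : Finset (Fin m)} {S : Finset (Fin n)}
    (hX : 4 ≤ X.card) (hS : 4 ≤ S.card) : ∃ i ∈ X, ∃ j ∈ S, M i j = true := by
  obtain ⟨X', hX', hX4⟩ := Finset.exists_subset_card_eq hX
  obtain ⟨S', hS', hS4⟩ := Finset.exists_subset_card_eq hS
  obtain ⟨a, b, h⟩ := hM.blue (X'.orderEmbOfFin hX4).toEmbedding (S'.orderEmbOfFin hS4).toEmbedding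
  exact ⟨_, hX' (Finset.orderEmbOfFin_mem _ hX4 a), _, hS' (Finset.orderEmbOfFin_mem _ hS4 b), h⟩

theorem IsGood.card_common_le_one (hM : IsGood M) {i i' : Fin m} (h : i ≠ i')
    (S : Finset (Fin n)) : (S.filter fun j => M i j = true ∧ M i' j = true).card ≤ 1 := by
  rw [Finset.card_le_one]
  intro j hj j' hj'
  by_contra hne
  simp only [Finset.mem_filter] at hj hj'
  exact Bool.false_ne_true ((hM.red i i' j j' h hne hj.2.1 hj'.2.1 hj.2.2).symm.trans hj'.2.2)

/-- Each ordered pair of distinct rows meets in at most one column of `S`, or in none. A column with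
`k` red entries in `X` accounts for `k(k-1)` pairs, and `4k ≤ k(k-1) + 6` because `(k-2)(k-3) ≥ 0`.
-/
theorem IsGood.four_mul_sum_card_le (hM : IsGood M) (X : Finset (Fin m)) (S : Finset (Fin n)) :
    4 * ∑ j ∈ S, (X.filter fun i => M i j = true).card +
      (X.offDiag.filter fun p => ∀ j ∈ S, ¬ (M p.1 j = true ∧ M p.2 j = true)).card ≤
        X.offDiag.card + 6 * S.card := by
  have h1 : ∀ j, 4 * (X.filter fun i => M i j = true).card ≤
      (X.offDiag.filter fun p => M p.1 j = true ∧ M p.2 j = true).card + 6 := by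
    intro j
    have : X.offDiag.filter (fun p => M p.1 j = true ∧ M p.2 j = true) =
        (X.filter fun i => M i j = true).offDiag := by
      ext p
      simp only [Finset.mem_filter, Finset.mem_offDiag]
      tauto
    rw [this, Finset.offDiag_card]
    generalize (X.filter fun i => M i j = true).card = k
    rcases le_or_gt k 1 with hk | hk
    · omega
    · obtain ⟨l, rfl⟩ := Nat.exists_eq_add_of_le hk
      have : (1 + 1 + l) * (1 + 1 + l) - (1 + 1 + l) = l * l + 3 * l + 2 := by
        rw [Nat.sub_eq_iff_eq_add (Nat.le_mul_self _)]
        ring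
      rw [Nat.succ_eq_add_one, this]
      have : l ≤ l * l := Nat.le_mul_self l
      omega
  have h2 : ∑ j ∈ S, (X.offDiag.filter fun p => M p.1 j = true ∧ M p.2 j = true).card +
      (X.offDiag.filter fun p => ∀ j ∈ S, ¬ (M p.1 j = true ∧ M p.2 j = true)).card ≤
        X.offDiag.card := by
    have := Finset.sum_card_bipartiteAbove_eq_sum_card_bipartiteBelow (s := S) (t := X.offDiag)
      fun j p => M p.1 j = true ∧ M p.2 j = true
    simp only [Finset.bipartiteAbove, Finset.bipartiteBelow] at this
    rw [this, Finset.card_filter, ← Finset.sum_add_distrib, Finset.card_eq_sum_ones]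
    refine Finset.sum_le_sum fun p hp => ?_
    split_ifs with h
    · rw [Finset.filter_false_of_mem h]
      simp
    · exact hM.card_common_le_one (Finset.mem_offDiag.mp hp).2.2 S
  rw [Finset.mul_sum]
  have h3 := Finset.sum_le_sum fun j (_ : j ∈ S) => h1 j
  rw [Finset.sum_add_distrib, Finset.sum_const, smul_eq_mul] at h3
  omega

/-- The columns without a red entry in the rows of `X`. -/
def missing (M : Fin m → Fin n → Bool) (X : Finset (Fin m)) : Finset (Fin n) :=
  Finset.univ.filter fun j => ∀ i ∈ X, M i j = false

theorem IsGood.card_missing_le_three (hM : IsGood M) {X : Finset (Fin m)} (hX : X.card = 4) :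
    (missing M X).card ≤ 3 := by
  by_contra h
  obtain ⟨i, hi, j, hj, hij⟩ := hM.exists_red hX.ge (S := missing M X) (by omega)
  simp [(Finset.mem_filter.mp hj).2 i hi] at hij

/-- Adding any outside row to `X` leaves at most `b` missing columns, so that row has at least
`(missing M X).card - b` red entries in `missing M X`. The pair count on `Xᶜ × missing M X` bounds
their total. -/
theorem IsGood.card_missing_of_succ (hM : IsGood M) {k b : ℕ}
    (h : ∀ X : Finset (Fin m), X.card = k + 1 → (missing M X).card ≤ b)
    {X : Finset (Fin m)} (hX : X.card = k) :
    4 * ((m - k) * ((missing M X).card - b)) ≤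
      ((m - k) * (m - k) - (m - k)) + 6 * (missing M X).card := by
  have hXc : Xᶜ.card = m - k := by rw [Finset.card_compl, Fintype.card_fin, hX]
  have h1 := hM.four_mul_sum_card_le Xᶜ (missing M X)
  have h2 := Finset.sum_card_bipartiteAbove_eq_sum_card_bipartiteBelow (s := missing M X)
    (t := Xᶜ) fun j i => M i j = true
  simp only [Finset.bipartiteAbove, Finset.bipartiteBelow] at h2
  have h3 : Xᶜ.card • ((missing M X).card - b) ≤
      ∑ i ∈ Xᶜ, ((missing M X).filter fun j => M i j = true).card := by
    refine Finset.card_nsmul_le_sum _ _ _ fun i hi => ?_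
    have h4 := h (insert i X) (by rw [Finset.card_insert_of_notMem (Finset.mem_compl.mp hi), hX])
    have h5 := (missing M X).card_filter_add_card_filter_not (p := fun j => M i j = true)
    have h6 : ((missing M X).filter fun j => ¬ M i j = true) = missing M (insert i X) := by
      ext j
      simp [missing, and_comm]
    rw [h6] at h5
    omega
  rw [← h2, smul_eq_mul, hXc] at h3
  rw [Finset.offDiag_card, hXc] at h1
  omega

section NineFourteen

variable {M : Fin 9 → Fin 14 → Bool}

/-- With `s` missing columns, this and the next two bounds solve `24(s-3) ≤ 30+6s`, `28(s-5) ≤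
42+6s` and `32(s-8) ≤ 56+6s`. -/
theorem IsGood.card_missing_le_five (hM : IsGood M) {X : Finset (Fin 9)} (hX : X.card = 3) :
    (missing M X).card ≤ 5 := by
  have := hM.card_missing_of_succ (fun X hX => hM.card_missing_le_three hX) hX
  omega

theorem IsGood.card_missing_le_eight (hM : IsGood M) {X : Finset (Fin 9)} (hX : X.card = 2) :
    (missing M X).card ≤ 8 := by
  have := hM.card_missing_of_succ (fun X hX => hM.card_missing_le_five hX) hX
  omega

theorem IsGood.card_missing_le_twelve (hM : IsGood M) {X : Finset (Fin 9)} (hX : X.card = 1) :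
    (missing M X).card ≤ 12 := by
  have := hM.card_missing_of_succ (fun X hX => hM.card_missing_le_eight hX) hX
  omega

theorem IsGood.two_le_degree (hM : IsGood M) (i : Fin 9) :
    2 ≤ (Finset.univ.filter fun j => M i j = true).card := by
  have h := hM.card_missing_le_twelve (Finset.card_singleton i)
  have h' := (Finset.univ : Finset (Fin 14)).card_filter_add_card_filter_not
    (p := fun j => M i j = true)
  simp only [missing, Finset.mem_singleton, forall_eq] at h
  simp only [Bool.not_eq_true, Finset.card_univ, Fintype.card_fin] at h'
  omega

/-- Given six red columns in row `p`, each of the other eight rows hits at most one of them. After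
the two most hit columns are dropped, some four columns are hit by at most four rows; the other four
or more rows give a blue `K_{4,4}`. -/
theorem IsGood.degree_le_five (hM : IsGood M) (p : Fin 9) :
    (Finset.univ.filter fun j => M p j = true).card ≤ 5 := by
  by_contra hlt
  set S := Finset.univ.filter fun j => M p j = true with hS
  let X : Finset (Fin 9) := Finset.univ.erase p
  let k : Fin 14 → ℕ := fun j => (X.filter fun i => M i j = true).card
  have hX : X.card = 8 := by simp [X]
  have hsum : ∑ j ∈ S, k j ≤ 8 := by
    have h2 := Finset.sum_card_bipartiteAbove_eq_sum_card_bipartiteBelow (s := S)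
      (t := X) fun j i => M i j = true
    simp only [Finset.bipartiteAbove, Finset.bipartiteBelow] at h2
    rw [show ∑ j ∈ S, k j = _ from h2, ← hX, Finset.card_eq_sum_ones X]
    refine Finset.sum_le_sum fun i hi => ?_
    refine le_trans (Finset.card_le_card ?_)
      (hM.card_common_le_one (Finset.ne_of_mem_erase hi).symm S)
    intro j hj
    simp only [Finset.mem_filter, hS, Finset.mem_univ, true_and] at hj ⊢
    exact ⟨hj.1, hj.1, hj.2⟩
  obtain ⟨c, hc, hcmax⟩ := S.exists_max_image k (Finset.card_pos.mp (by omega))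
  have hSc : (S.erase c).card = S.card - 1 := Finset.card_erase_of_mem hc
  obtain ⟨d, hd, hdmax⟩ := (S.erase c).exists_max_image k (Finset.card_pos.mp (by omega))
  have hSd : ((S.erase c).erase d).card = (S.erase c).card - 1 := Finset.card_erase_of_mem hd
  obtain ⟨T, hT, hT4⟩ := Finset.exists_subset_card_eq (show 4 ≤ ((S.erase c).erase d).card by omega)
  have h1 : ∑ j ∈ T, k j ≤ ∑ j ∈ (S.erase c).erase d, k j := Finset.sum_le_sum_of_subset hT
  have h2 := Finset.add_sum_erase _ k hd
  have h3 := Finset.add_sum_erase _ k hc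
  have h4 := hcmax d (Finset.mem_of_mem_erase hd)
  have h5 : ∑ j ∈ T, k j ≤ T.card • k d :=
    Finset.sum_le_card_nsmul _ _ _ fun j hj => hdmax j (Finset.mem_of_mem_erase (hT hj))
  rw [hT4, smul_eq_mul] at h5
  have hhit : (T.biUnion fun j => X.filter fun i => M i j = true).card ≤ 4 :=
    -- If `k d ≤ 1`, the four columns of `T` total at most 4. If `k d ≥ 2`, then `c` and `d` already
    -- use 4 of the 8 hits.
    Finset.card_biUnion_le.trans (show ∑ j ∈ T, k j ≤ 4 by omega)
  have hmiss := Finset.le_card_sdiff (T.biUnion fun j => X.filter fun i => M i j = true) X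
  obtain ⟨i, hi, j, hj, hij⟩ := hM.exists_red
    (X := X \ T.biUnion fun j => X.filter fun i => M i j = true) (by omega) hT4.ge
  rw [Finset.mem_sdiff] at hi
  exact hi.2 (Finset.mem_biUnion.mpr ⟨j, hj, Finset.mem_filter.mpr ⟨hi.1, hij⟩⟩)

end NineFourteen

/-! ### From a maximal good colouring to a row system -/

theorem bitCount_eq_card_filter {x : ℕ} (hx : x < 2 ^ 14) {p : Fin 14 → Prop} [DecidablePred p]
    (h : ∀ j : Fin 14, x.testBit j = true ↔ p j) :
    bitCount x = (Finset.univ.filter p).card := by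
  rw [bitCount_eq_card hx]
  exact congrArg Finset.card (Finset.filter_congr fun j _ => h j)

theorem bitCount_ofBits (f : Fin 14 → Bool) :
    bitCount (Nat.ofBits f) = (Finset.univ.filter fun j => f j = true).card :=
  bitCount_eq_card_filter (Nat.ofBits_lt_two_pow f) fun j => by
    rw [Nat.testBit_ofBits_lt _ _ j.isLt]

theorem countContaining_cons (x c : ℕ) (l : List ℕ) :
    countContaining x (c :: l) = countContaining x l + if x &&& c = x then 1 else 0 := by
  change Bool.rec (motive := fun _ => ℕ) _ (Nat.succ _) (Nat.beq (x &&& c) x) = _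
  by_cases h : x &&& c = x
  · rw [if_pos h, Nat.beq_eq.mpr h]; rfl
  · rw [if_neg h, Bool.eq_false_iff.mpr fun h' => h (Nat.beq_eq.mp h')]; rfl

theorem countContaining_complements (r : ℕ → ℕ) (x k : ℕ) :
    countContaining x (complements r k) =
      ((Finset.range k).filter fun i => x &&& compl (r i) = x).card := by
  induction k with
  | zero => rfl
  | succ k ih =>
    rw [complements, countContaining_cons, ih, Finset.card_filter, Finset.card_filter,
      Finset.sum_range_succ]

/-- The rows of `M` as numbers. -/
def rowNumber (M : Fin 9 → Fin 14 → Bool) (i : ℕ) : ℕ :=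
  if h : i < 9 then Nat.ofBits (M ⟨i, h⟩) else 0

/-- The sequence that is lexicographically maximal for the chosen ordering of a colouring. -/
def matrixKey (M : Fin 9 → Fin 14 → Bool) : Lex (Fin 9 → ℕ) :=
  toLex fun i => rowKey (Nat.ofBits (M i))

theorem matrixKey_lt {M M' : Fin 9 → Fin 14 → Bool} (k : Fin 9) (h : ∀ i < k, M i = M' i)
    (hk : rowKey (Nat.ofBits (M k)) < rowKey (Nat.ofBits (M' k))) : matrixKey M < matrixKey M' :=
  ⟨k, fun i hi => congrArg (fun f => rowKey (Nat.ofBits f)) (h i hi), hk⟩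

theorem IsGood.exists_max {M : Fin 9 → Fin 14 → Bool} (hM : IsGood M) :
    ∃ M' : Fin 9 → Fin 14 → Bool, IsGood M' ∧
      ∀ N : Fin 9 → Fin 14 → Bool, IsGood N → matrixKey N ≤ matrixKey M' :=
  Set.exists_max_image {M : Fin 9 → Fin 14 → Bool | IsGood M} matrixKey (Set.toFinite _) ⟨M, hM⟩

section NineRows

variable {M : Fin 9 → Fin 14 → Bool}

theorem rowNumber_of_lt {i : ℕ} (hi : i < 9) : rowNumber M i = Nat.ofBits (M ⟨i, hi⟩) := dif_pos hi

theorem testBit_rowNumber {i : ℕ} (hi : i < 9) (j : Fin 14) :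
    (rowNumber M i).testBit j = M ⟨i, hi⟩ j := by
  rw [rowNumber_of_lt hi, Nat.testBit_ofBits_lt _ _ j.isLt]

theorem rowNumber_lt {i : ℕ} (hi : i < 9) : rowNumber M i < 2 ^ 14 := by
  rw [rowNumber_of_lt hi]
  exact Nat.ofBits_lt_two_pow _

theorem testBit_compl_rowNumber {i : ℕ} (hi : i < 9) (j : Fin 14) :
    (compl (rowNumber M i)).testBit j = !M ⟨i, hi⟩ j := by
  rw [testBit_compl, testBit_rowNumber hi]
  simp [j.isLt]

theorem IsGood.rowKey_anti (hM : IsGood M)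
    (hmax : ∀ N : Fin 9 → Fin 14 → Bool, IsGood N → matrixKey N ≤ matrixKey M)
    {i j : Fin 9} (hij : i < j) : rowKey (Nat.ofBits (M j)) ≤ rowKey (Nat.ofBits (M i)) := by
  by_contra h
  refine (hmax _ (hM.comp (Equiv.swap i j).toEmbedding (Function.Embedding.refl _))).not_gt
    (matrixKey_lt i (fun a ha => ?_) ?_)
  · funext b
    simp [Equiv.swap_apply_of_ne_of_ne ha.ne (ha.trans hij).ne]
  · simpa using h

/-- Otherwise swapping the two columns fixes the rows above `k`, keeps the weight of row `k` and
moves a one to a higher bit, which increases `matrixKey`. -/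
theorem IsGood.columns_sorted (hM : IsGood M)
    (hmax : ∀ N : Fin 9 → Fin 14 → Bool, IsGood N → matrixKey N ≤ matrixKey M)
    (k : Fin 9) {j j' : Fin 14} (hj : j < j') (hjj : ∀ b, j' < b → b ≠ j)
    (h : ∀ i < k, M i j = M i j') (hk : M k j = true) : M k j' = true := by
  by_contra hk'
  rw [Bool.not_eq_true] at hk'
  refine (hmax _ (hM.comp (Function.Embedding.refl _) (Equiv.swap j j').toEmbedding)).not_gt
    (matrixKey_lt k (fun a ha => ?_) ?_)
  · funext b
    change M a b = M a (Equiv.swap j j' b)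
    rcases eq_or_ne b j with rfl | hb
    · rw [Equiv.swap_apply_left, h a ha]
    · rcases eq_or_ne b j' with rfl | hb'
      · rw [Equiv.swap_apply_right, h a ha]
      · rw [Equiv.swap_apply_of_ne_of_ne hb hb']
  · change rowKey (Nat.ofBits (M k)) < rowKey (Nat.ofBits fun b => M k (Equiv.swap j j' b))
    have h1 : bitCount (Nat.ofBits fun b => M k (Equiv.swap j j' b)) =
        bitCount (Nat.ofBits (M k)) := by
      rw [bitCount_ofBits, bitCount_ofBits]
      exact Finset.card_equiv (Equiv.swap j j') (by simp)
    have h2 : Nat.ofBits (M k) < Nat.ofBits fun b => M k (Equiv.swap j j' b) := by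
      refine Nat.lt_of_testBit j' ?_ ?_ fun b hb => ?_
      · rw [Nat.testBit_ofBits_lt _ _ j'.isLt, hk']
      · rw [Nat.testBit_ofBits_lt _ _ j'.isLt, Equiv.swap_apply_right, hk]
      · by_cases hb14 : b < 14
        · rw [Nat.testBit_ofBits_lt _ _ hb14, Nat.testBit_ofBits_lt _ _ hb14,
            Equiv.swap_apply_of_ne_of_ne (hjj ⟨b, hb14⟩ hb)
              (Fin.ne_of_gt (show j' < ⟨b, hb14⟩ from hb))]
        · rw [Nat.testBit_ofBits_ge _ _ (by omega), Nat.testBit_ofBits_ge _ _ (by omega)]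
    rw [rowKey_eq, rowKey_eq, h1]
    omega

/-- With `E` red entries and `D` disjoint pairs of rows, the pair count on the full matrix reads `4E
+ 2D ≤ 72 + 84`; the weights add up to `2E + D`. -/
theorem IsGood.sum_weight_le (hM : IsGood M) :
    ∑ k ∈ Finset.range 9, weight (rowNumber M) k ≤ 78 := by
  let disj : Fin 9 × Fin 9 → Prop := fun p => ∀ j, ¬ (M p.1 j = true ∧ M p.2 j = true)
  let A := (Finset.univ : Finset (Fin 9 × Fin 9)).filter fun p => p.1 < p.2 ∧ disj p
  have hland : ∀ i k : Fin 9, Nat.ofBits (M k) &&& compl (rowNumber M i) = Nat.ofBits (M k) ↔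
      disj (i, k) := by
    intro i k
    constructor
    · intro h j hj
      have := congrArg (fun x => x.testBit j) h
      simp [testBit_compl_rowNumber i.isLt, Nat.testBit_ofBits_lt _ _ j.isLt, hj.1, hj.2] at this
    · intro h
      refine Nat.eq_of_testBit_eq fun j => ?_
      by_cases hj : j < 14
      · have h1 := h ⟨j, hj⟩
        have h2 := testBit_compl_rowNumber (M := M) i.isLt ⟨j, hj⟩
        simp only at h1 h2
        rw [Nat.testBit_and, h2, Nat.testBit_ofBits_lt _ _ hj]
        revert h1
        cases M k ⟨j, hj⟩ <;> cases M i ⟨j, hj⟩ <;> simp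
      · rw [Nat.testBit_and, Nat.testBit_ofBits_ge _ _ (by omega), Bool.false_and]
  have hw : ∀ k : Fin 9, weight (rowNumber M) k =
      2 * (Finset.univ.filter fun j => M k j = true).card +
        (Finset.univ.filter fun i => i < k ∧ disj (i, k)).card := by
    intro k
    rw [weight, rowNumber_of_lt k.isLt, bitCount_ofBits, mul_comm, countContaining_complements]
    congr 1
    symm
    refine Finset.card_bij (fun i _ => i) (fun i hi => ?_) (fun _ _ _ _ h => Fin.ext h)
      fun i hi => ?_
    · simp only [Finset.mem_filter, Finset.mem_univ, true_and] at hi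
      exact Finset.mem_filter.mpr ⟨Finset.mem_range.mpr hi.1, (hland i k).mpr hi.2⟩
    · obtain ⟨hik, hi'⟩ := Finset.mem_filter.mp hi
      have hik := Finset.mem_range.mp hik
      have hi9 : i < 9 := hik.trans k.isLt
      exact ⟨⟨i, hi9⟩, Finset.mem_filter.mpr
        ⟨Finset.mem_univ _, hik, (hland ⟨i, hi9⟩ k).mp hi'⟩, rfl⟩
  have hA : ∑ k : Fin 9, (Finset.univ.filter fun i => i < k ∧ disj (i, k)).card = A.card := by
    simp only [A, Finset.card_filter]
    rw [Fintype.sum_prod_type_right]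
  have h := hM.four_mul_sum_card_le Finset.univ Finset.univ
  have h2 : 2 * A.card ≤ (Finset.univ.offDiag.filter fun p : Fin 9 × Fin 9 =>
      ∀ j ∈ Finset.univ, ¬ (M p.1 j = true ∧ M p.2 j = true)).card := by
    -- Each unordered disjoint pair yields two ordered ones: `A` and its mirror image are disjoint.
    have hB : (A.map (Equiv.prodComm _ _).toEmbedding).card = A.card := Finset.card_map _
    rw [two_mul]
    nth_rw 2 [← hB]
    rw [← Finset.card_union_of_disjoint]
    · refine Finset.card_le_card fun p hp => ?_
      simp only [Finset.mem_union, Finset.mem_map, A, disj, Finset.mem_filter, Finset.mem_univ,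
        true_and, forall_true_left, Finset.mem_offDiag] at hp ⊢
      rcases hp with hp | ⟨q, hq, rfl⟩
      · exact ⟨hp.1.ne, hp.2⟩
      · exact ⟨hq.1.ne', fun j hj => hq.2 j hj.symm⟩
    · rw [Finset.disjoint_left]
      intro p hp hp'
      simp only [Finset.mem_map, A, Finset.mem_filter, Finset.mem_univ, true_and] at hp hp'
      obtain ⟨q, hq, rfl⟩ := hp'
      exact lt_asymm hp.1 hq.1
  have h3 := Finset.sum_card_bipartiteAbove_eq_sum_card_bipartiteBelow
    (s := (Finset.univ : Finset (Fin 14))) (t := (Finset.univ : Finset (Fin 9)))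
    fun j i => M i j = true
  simp only [Finset.bipartiteAbove, Finset.bipartiteBelow] at h3
  rw [Finset.sum_range, Finset.sum_congr rfl fun k _ => hw k, Finset.sum_add_distrib, hA,
    ← Finset.mul_sum, ← h3]
  rw [Finset.offDiag_card] at h
  simp only [Finset.card_univ, Fintype.card_fin] at h
  omega

theorem IsGood.isRowSystem (hM : IsGood M)
    (hmax : ∀ N : Fin 9 → Fin 14 → Bool, IsGood N → matrixKey N ≤ matrixKey M) :
    IsRowSystem (rowNumber M) where
  lt i hi := rowNumber_lt hi
  two_le i hi := by
    rw [rowNumber_of_lt hi, bitCount_ofBits]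
    exact hM.two_le_degree _
  le_five i hi := by
    rw [rowNumber_of_lt hi, bitCount_ofBits]
    exact hM.degree_le_five _
  anti i j hij hj := by
    rw [rowNumber_of_lt hj, rowNumber_of_lt (hij.trans hj)]
    exact hM.rowKey_anti hmax hij
  meet i j hij hj := by
    have hi := hij.trans hj
    rw [bitCount_eq_card_filter (Nat.and_lt_two_pow _ (rowNumber_lt hj))
      (p := fun b => M ⟨i, hi⟩ b = true ∧ M ⟨j, hj⟩ b = true)]
    · exact hM.card_common_le_one (Fin.ne_of_lt hij) _
    · intro b
      rw [Nat.testBit_and, testBit_rowNumber hi, testBit_rowNumber hj, Bool.and_eq_true]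
  miss_two i j hij hj := by
    have hi := hij.trans hj
    rw [bitCount_eq_card_filter (Nat.and_lt_two_pow _ (compl_lt (rowNumber_lt hj)))
      (p := fun b => ∀ a ∈ ({⟨i, hi⟩, ⟨j, hj⟩} : Finset (Fin 9)), M a b = false)]
    · refine hM.card_missing_le_eight ?_
      rw [Finset.card_pair]
      simpa using hij.ne
    · intro b
      simp [Nat.testBit_and, testBit_compl_rowNumber hi, testBit_compl_rowNumber hj]
  miss_three i j k hij hjk hk := by
    have hj := hjk.trans hk
    have hi := hij.trans hj
    rw [bitCount_eq_card_filter (Nat.and_lt_two_pow _ (compl_lt (rowNumber_lt hk)))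
      (p := fun b => ∀ a ∈ ({⟨i, hi⟩, ⟨j, hj⟩, ⟨k, hk⟩} : Finset (Fin 9)), M a b = false)]
    · refine hM.card_missing_le_five ?_
      rw [Finset.card_insert_of_notMem, Finset.card_pair]
      · simpa using hjk.ne
      · simpa using ⟨hij.ne, (hij.trans hjk).ne⟩
    · intro b
      simp [Nat.testBit_and, testBit_compl_rowNumber hi, testBit_compl_rowNumber hj,
        testBit_compl_rowNumber hk, and_assoc]
  miss_four i j k l hij hjk hkl hl := by
    have hk := hkl.trans hl
    have hj := hjk.trans hk
    have hi := hij.trans hj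
    rw [bitCount_eq_card_filter (Nat.and_lt_two_pow _ (compl_lt (rowNumber_lt hl)))
      (p := fun b => ∀ a ∈ ({⟨i, hi⟩, ⟨j, hj⟩, ⟨k, hk⟩, ⟨l, hl⟩} : Finset (Fin 9)), M a b = false)]
    · refine hM.card_missing_le_three ?_
      rw [Finset.card_insert_of_notMem, Finset.card_insert_of_notMem, Finset.card_pair]
      · simpa using hkl.ne
      · simpa using ⟨hjk.ne, (hjk.trans hkl).ne⟩
      · simpa using ⟨hij.ne, (hij.trans hjk).ne, (hij.trans (hjk.trans hkl)).ne⟩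
    · intro b
      simp [Nat.testBit_and, testBit_compl_rowNumber hi, testBit_compl_rowNumber hj,
        testBit_compl_rowNumber hk, testBit_compl_rowNumber hl, and_assoc]
  sorted k hk j hj h h1 := by
    have e : ∀ i (hi : i < 9), (rowNumber M i).testBit j = M ⟨i, hi⟩ ⟨j, by omega⟩ :=
      fun i hi => testBit_rowNumber hi ⟨j, by omega⟩
    have e' : ∀ i (hi : i < 9), (rowNumber M i).testBit (j + 1) = M ⟨i, hi⟩ ⟨j + 1, by omega⟩ :=
      fun i hi => testBit_rowNumber hi ⟨j + 1, by omega⟩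
    rw [e' k hk]
    rw [e k hk] at h1
    refine hM.columns_sorted hmax ⟨k, hk⟩ (j := ⟨j, by omega⟩) (Fin.mk_lt_mk.mpr j.lt_succ_self)
      (fun b hb => ?_) (fun i hi => ?_) h1
    · rintro rfl
      exact absurd hb (by simp)
    · have := h i hi
      rwa [e i i.isLt, e' i i.isLt] at this
  weight_le := hM.sum_weight_le

theorem not_isGood (M : Fin 9 → Fin 14 → Bool) : ¬ IsGood M := fun hM =>
  let ⟨_, hM', hmax⟩ := hM.exists_max
  not_isRowSystem _ (hM'.isRowSystem hmax)

end NineRows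

/-! ### Graph copies and matrices -/

/-- A copy of a complete bipartite graph in a bipartite graph respects the two sides, up to
exchanging them. -/
theorem exists_embeddings_of_isContained {G : SimpleGraph (Fin m ⊕ Fin n)}
    (hG : G ≤ completeBipartiteGraph (Fin m) (Fin n)) {k : ℕ} (hk : 0 < k)
    (h : (completeBipartiteGraph (Fin k) (Fin k)).IsContained G) :
    ∃ (f : Fin k ↪ Fin m) (g : Fin k ↪ Fin n), ∀ a b, G.Adj (Sum.inl (f a)) (Sum.inr (g b)) := by
  obtain ⟨φ⟩ := h
  have hadj : ∀ a b : Fin k, G.Adj (φ (Sum.inl a)) (φ (Sum.inr b)) := fun a b =>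
    φ.toHom.map_adj (by simp)
  have hside : ∀ x y, G.Adj x y → x.isLeft = !y.isLeft := by
    intro x y hxy
    have := hG hxy
    cases x <;> cases y <;> simp_all
  have hinj : ∀ x y, φ x = φ y → x = y := fun _ _ h => φ.injective h
  let z : Fin k := ⟨0, hk⟩
  cases hz : (φ (Sum.inl z)).isLeft with
  | true =>
    have hr : ∀ b, ∃ j, φ (Sum.inr b) = Sum.inr j := fun b => by
      have := hside _ _ (hadj z b)
      cases h : φ (Sum.inr b) <;> simp_all
    have hl : ∀ a, ∃ i, φ (Sum.inl a) = Sum.inl i := fun a => by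
      have := hside _ _ (hadj a z)
      obtain ⟨j, hj⟩ := hr z
      cases h : φ (Sum.inl a) <;> simp_all
    choose g hg using hr
    choose f hf using hl
    refine ⟨⟨f, fun a a' h => ?_⟩, ⟨g, fun b b' h => ?_⟩, fun a b => ?_⟩
    · exact Sum.inl_injective (hinj _ _ (by rw [hf, hf, h]))
    · exact Sum.inr_injective (hinj _ _ (by rw [hg, hg, h]))
    · have := hadj a b
      rwa [hf, hg] at this
  | false =>
    -- The copy is flipped; both parts have size `k`, so they exchange roles.
    have hr : ∀ b, ∃ i, φ (Sum.inr b) = Sum.inl i := fun b => by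
      have := hside _ _ (hadj z b)
      cases h : φ (Sum.inr b) <;> simp_all
    have hl : ∀ a, ∃ j, φ (Sum.inl a) = Sum.inr j := fun a => by
      have := hside _ _ (hadj a z)
      obtain ⟨j, hj⟩ := hr z
      cases h : φ (Sum.inl a) <;> simp_all
    choose f hf using hr
    choose g hg using hl
    refine ⟨⟨f, fun a a' h => ?_⟩, ⟨g, fun b b' h => ?_⟩, fun a b => ?_⟩
    · exact Sum.inr_injective (hinj _ _ (by rw [hf, hf, h]))
    · exact Sum.inl_injective (hinj _ _ (by rw [hg, hg, h]))
    · have := (hadj b a).symm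
      rwa [hf, hg] at this

theorem isContained_of_embeddings {G : SimpleGraph (Fin m ⊕ Fin n)} {k : ℕ}
    (f : Fin k ↪ Fin m) (g : Fin k ↪ Fin n)
    (h : ∀ a b, G.Adj (Sum.inl (f a)) (Sum.inr (g b))) :
    (completeBipartiteGraph (Fin k) (Fin k)).IsContained G := by
  refine ⟨⟨⟨Sum.map f g, fun {x y} hxy => ?_⟩, Sum.map_injective.mpr ⟨f.injective, g.injective⟩⟩⟩
  rcases x with a | a <;> rcases y with b | b <;> simp at hxy
  · exact h a b
  · exact (h b a).symm

/-- The red graph of the colouring `M`. -/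
def redGraph (M : Fin m → Fin n → Bool) : SimpleGraph (Fin m ⊕ Fin n) :=
  SimpleGraph.fromRel fun x y => ∃ i j, x = Sum.inl i ∧ y = Sum.inr j ∧ M i j = true

theorem redGraph_adj (M : Fin m → Fin n → Bool) (i : Fin m) (j : Fin n) :
    (redGraph M).Adj (Sum.inl i) (Sum.inr j) ↔ M i j = true := by
  simp [redGraph]

theorem redGraph_le (M : Fin m → Fin n → Bool) :
    redGraph M ≤ completeBipartiteGraph (Fin m) (Fin n) := by
  intro x y h
  rw [redGraph, SimpleGraph.fromRel_adj] at h
  rcases h.2 with ⟨i, j, rfl, rfl, -⟩ | ⟨i, j, rfl, rfl, -⟩ <;> simp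

theorem bipartiteArrows_iff : BipartiteArrows m n (completeBipartiteGraph (Fin 2) (Fin 2))
    (completeBipartiteGraph (Fin 4) (Fin 4)) ↔ ∀ M : Fin m → Fin n → Bool, ¬ IsGood M := by
  classical
  constructor
  · intro h M hM
    rcases h (redGraph M) (redGraph_le M) with h | h
    · obtain ⟨f, g, hfg⟩ := exists_embeddings_of_isContained (redGraph_le M) two_pos h
      simp only [redGraph_adj] at hfg
      have := hM.red (f 0) (f 1) (g 0) (g 1) (f.injective.ne (by decide))
        (g.injective.ne (by decide)) (hfg 0 0) (hfg 0 1) (hfg 1 0)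
      exact Bool.false_ne_true (this.symm.trans (hfg 1 1))
    · obtain ⟨f, g, hfg⟩ := exists_embeddings_of_isContained sdiff_le four_pos h
      obtain ⟨a, b, hab⟩ := hM.blue f g
      exact (SimpleGraph.sdiff_adj _ _ _ _ |>.mp (hfg a b)).2 ((redGraph_adj M _ _).mpr hab)
  · intro h G hG
    by_contra hcon
    rw [not_or] at hcon
    refine h (fun i j => decide (G.Adj (Sum.inl i) (Sum.inr j))) ⟨?_, ?_⟩
    · intro i i' j j' hi hj h1 h2 h3
      by_contra h4
      simp only [decide_eq_true_eq, decide_eq_false_iff_not, not_not] at h1 h2 h3 h4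
      refine hcon.1 (isContained_of_embeddings ⟨![i, i'], ?_⟩ ⟨![j, j'], ?_⟩ ?_)
      · intro a b; fin_cases a <;> fin_cases b <;> simp [hi, hi.symm]
      · intro a b; fin_cases a <;> fin_cases b <;> simp [hj, hj.symm]
      · intro a b
        fin_cases a <;> fin_cases b <;> assumption
    · intro f g
      by_contra h4
      push Not at h4
      refine hcon.2 (isContained_of_embeddings f g fun a b => ?_)
      rw [SimpleGraph.sdiff_adj]
      exact ⟨by simp, by simpa using h4 a b⟩

/-! ### The affine plane colouring -/

/-- The incidence matrix of the points and lines of the affine plane of order three, with the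
point `(x, y)` at `3 * x + y`, and with an empty thirteenth column. The first nine columns are
the lines `y = a * x + b`, the next three the lines `x = b`. -/
def affinePlane (i : Fin 9) (j : Fin 13) : Bool :=
  if j.val < 9 then i.val % 3 == (j.val / 3 * (i.val / 3) + j.val % 3) % 3
  else i.val / 3 + 9 == j.val

set_option maxRecDepth 100000 in
theorem affinePlane_red : ∀ i i' : Fin 9, i ≠ i' →
    (Finset.univ.filter fun j => affinePlane i j = true ∧ affinePlane i' j = true).card ≤ 1 := by
  decide +kernel

-- Four points have 16 incidences and 6 pairs, each pair on one line, so they hit 16 - 6 = 10 lines,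
-- plus one if three of them are collinear. At most two lines and the empty column are missed.
set_option maxRecDepth 100000 in
theorem affinePlane_blue : ∀ a b : Fin 9, a < b → ∀ c, b < c → ∀ d, c < d →
    (Finset.univ.filter fun j => ¬ (affinePlane a j || affinePlane b j || affinePlane c j ||
      affinePlane d j) = true).card ≤ 3 := by
  decide +kernel

theorem isGood_affinePlane : IsGood affinePlane where
  red i i' j j' hi hj h1 h2 h3 := by
    by_contra h4
    rw [Bool.not_eq_false] at h4
    exact hj (Finset.card_le_one.mp (affinePlane_red i i' hi) j (by simp [h1, h3]) j'
      (by simp [h2, h4]))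
  blue f g := by
    by_contra h
    push Not at h
    let X := Finset.univ.map f
    have hX : X.card = 4 := by simp [X]
    -- The finite check covers increasing quadruples only, so the four rows are listed in order.
    let e := X.orderEmbOfFin hX
    have he : ∀ a b, affinePlane (e a) (g b) = false := by
      intro a b
      obtain ⟨a', -, ha'⟩ := Finset.mem_map.mp (Finset.orderEmbOfFin_mem X hX a)
      have := h a' b
      rw [ha'] at this
      exact Bool.eq_false_iff.mpr this
    have h1 := affinePlane_blue (e 0) (e 1) (e.strictMono (by decide)) (e 2)
      (e.strictMono (by decide)) (e 3) (e.strictMono (by decide))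
    have h2 : (Finset.univ.map g).card ≤ _ := Finset.card_le_card (fun j hj => by
      obtain ⟨b, -, rfl⟩ := Finset.mem_map.mp hj
      simp only [Finset.mem_filter, Finset.mem_univ, true_and, he]
      simp) |>.trans h1
    simp at h2

end BipartiteRamsey

theorem mainTheorem3 :
    IsBipartiteRamseyNumber 9 (completeBipartiteGraph (Fin 2) (Fin 2))
      (completeBipartiteGraph (Fin 4) (Fin 4)) 14 := by
  refine ⟨BipartiteRamsey.bipartiteArrows_iff.mpr BipartiteRamsey.not_isGood, fun n hn => ?_⟩
  by_contra h
  exact BipartiteRamsey.bipartiteArrows_iff.mp hn _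
    (BipartiteRamsey.isGood_affinePlane.comp (Function.Embedding.refl _) (Fin.castLEEmb (show n ≤ 13 by omega)))
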